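/- Let $(\Omega,\mathcal F,\mathbb P)$ be a probability space, let $\mathcal H_1\subset L^2(\Omega,\mathcal F,\mathbb P)$ be a Gaussian Hilbert space (a closed linear subspace all of whose elements are centered Gaussian random variables), and suppose that $\mathcal F$ is the $\sigma$-field generated by $\mathcal H_1$ (including null sets, i.e. by all random variables that are a.s. equal to an element of $\mathcal H_1$). Let $\mathcal H$ be a real separable Hilbert space and $W:\mathcal H\to\mathcal H_1$ a unitary operator, so that $\mathbb E[W(h)W(k)]=\langle h,k\rangle_{\mathcal H}$. For a real polynomial $q$ in $m$ variables and $h_1,\dots,h_m\in\mathcal H$ put $$D\,q(W(h_1),\dots,W(h_m))=\sum_{i=1}^m\partial_i q(W(h_1),\dots,W(h_m))\,h_i .$$ The closure of this operator, from $L^2(\Omega)$ to $L^2(\Omega;\mathcal H)$, is the Malliavin derivative $D$, with domain $\mathbb D^{1,2}$. The divergence operator $\delta$ is the adjoint of $D$: $\mathrm{Dom}(\delta)$ is the set of $u\in L^2(\Omega;\mathcal H)$ for which there is a constant $C$ with $|\mathbb E\langle DG,u\rangle_{\mathcal H}|\le C\|G\|_{L^2(\Omega)}$ for all $G\in\mathbb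 D^{1,2}$, and for such $u$, $\delta(u)\in L^2(\Omega)$ is characterized by $\mathbb E[G\,\delta(u)]=\mathbb E\langle DG,u\rangle_{\mathcal H}$ for all $G\in\mathbb D^{1,2}$. Let $F\in\mathbb D^{1,2}$ be such that $\|DF\|_{\mathcal H}>0$ a.s. and $\dfrac{DF}{\|DF\|_{\mathcal H}^2}\in\mathrm{Dom}(\delta)$. Then the law of $F$ is absolutely continuous with respect to the Lebesgue measure on $\mathbb R$, with the density $$p(x)=\mathbb E\left[\mathbf 1_{\{F>x\}}\,\delta\!\left(\frac{DF}{\|DF\|_{\mathcal H}^2}\right)\right],\qquad x\in\mathbb R,$$ and the function $p$ is nonnegative, continuous and bounded. -/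

import Mathlib

open MeasureTheory ProbabilityTheory

namespace Malliavin

variable {Ω : Type*} [mΩ : MeasurableSpace Ω] {P : Measure Ω}

/-- A Gaussian Hilbert space: a closed linear subspace of `L²(Ω, ℱ, P)` all of whose elements are
centered Gaussian random variables (the variance `0` is allowed). -/
structure IsGaussianHilbertSpace (H₁ : Submodule ℝ (Lp ℝ 2 P)) : Prop where
  isClosed : IsClosed (H₁ : Set (Lp ℝ 2 P))
  gaussian : ∀ ξ ∈ H₁, ∃ v : NNReal, P.map (ξ : Ω → ℝ) = gaussianReal 0 v

/-- The `σ`-field generated by the random variables in `H₁`, i.e. by all measurable functions whose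
almost sure class lies in `H₁`. (As `0 ∈ H₁`, it contains the measurable null sets.) -/
def generatedSigmaField (H₁ : Submodule ℝ (Lp ℝ 2 P)) : MeasurableSpace Ω :=
  ⨆ X : {X : Ω → ℝ // Measurable X ∧ ∃ ξ ∈ H₁, X =ᵐ[P] (ξ : Ω → ℝ)},
    MeasurableSpace.comap X.1 inferInstance

variable {H : Type*} [NormedAddCommGroup H] [InnerProductSpace ℝ H]
  {H₁ : Submodule ℝ (Lp ℝ 2 P)}

/-- The graph of the derivative on polynomial random variables: all pairs `(F, DF)` with
`F = p(W(h₁), …, W(hₘ))` and `DF = ∑ᵢ ∂ᵢp(W(h₁), …, W(hₘ)) hᵢ`, for a real polynomial `p`. -/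
def polynomialGraph (W : H ≃ₗᵢ[ℝ] H₁) : Set (Lp ℝ 2 P × Lp H 2 P) :=
  {z | ∃ (m : ℕ) (p : MvPolynomial (Fin m) ℝ) (h : Fin m → H),
    (z.1 : Ω → ℝ) =ᵐ[P]
      (fun ω => MvPolynomial.eval (fun i => (W (h i) : Lp ℝ 2 P) ω) p) ∧
    (z.2 : Ω → H) =ᵐ[P]
      (fun ω => ∑ i, MvPolynomial.eval (fun j => (W (h j) : Lp ℝ 2 P) ω)
        (MvPolynomial.pderiv i p) • h i)}

/-- `HasMalliavinDeriv W F G`: the pair `(F, G)` lies in the graph of the closure of the derivative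
on polynomial random variables, as an operator from `L²(Ω)` to `L²(Ω; H)`. -/
def HasMalliavinDeriv (W : H ≃ₗᵢ[ℝ] H₁) (F : Lp ℝ 2 P) (G : Lp H 2 P) : Prop :=
  (F, G) ∈ closure (polynomialGraph W)

/-- The space `𝔻^{1,2}`, the domain of the Malliavin derivative in `L²(Ω)`. -/
def D12 (W : H ≃ₗᵢ[ℝ] H₁) : Set (Lp ℝ 2 P) :=
  {F | ∃ G, HasMalliavinDeriv W F G}

open Classical in
/-- The Malliavin derivative `D` on `𝔻^{1,2}` (and `0` outside). The derivative on polynomial random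
variables is closable for a Gaussian Hilbert space, so that `G` below is unique. -/
noncomputable def malliavinDeriv (W : H ≃ₗᵢ[ℝ] H₁) (F : Lp ℝ 2 P) : Lp H 2 P :=
  if h : ∃ G, HasMalliavinDeriv W F G then h.choose else 0

/-- The domain of the divergence operator: those `u ∈ L²(Ω; H)` for which there is a constant `C`
with `|E⟨DF, u⟩| ≤ C ‖F‖_{L²}` for all `F ∈ 𝔻^{1,2}`. -/
def divergenceDomain (W : H ≃ₗᵢ[ℝ] H₁) : Set (Lp H 2 P) :=
  {u | ∃ C : ℝ, ∀ (F : Lp ℝ 2 P) (G : Lp H 2 P), HasMalliavinDeriv W F G →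
    |∫ ω, inner ℝ (G ω) (u ω) ∂P| ≤ C * ‖F‖}

/-- `v` satisfies the duality relation `E[F v] = E⟨DF, u⟩` for all `F ∈ 𝔻^{1,2}`. -/
def HasDivergence (W : H ≃ₗᵢ[ℝ] H₁) (u : Lp H 2 P) (v : Lp ℝ 2 P) : Prop :=
  ∀ (F : Lp ℝ 2 P) (G : Lp H 2 P), HasMalliavinDeriv W F G →
    ∫ ω, F ω * v ω ∂P = ∫ ω, inner ℝ (G ω) (u ω) ∂P

open Classical in
/-- The divergence operator `δ`, adjoint of `D`: the element of `L²(Ω)` satisfying the duality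
relation. It exists exactly for `u` in `divergenceDomain W` (Riesz), and it is unique when `ℱ` is
the `σ`-field generated by the Gaussian Hilbert space, as `𝔻^{1,2}` is then dense in `L²(Ω)`. -/
noncomputable def divergence (W : H ≃ₗᵢ[ℝ] H₁) (u : Lp H 2 P) : Lp ℝ 2 P :=
  if h : ∃ v, HasDivergence W u v then h.choose else 0

end Malliavin

open Filter Topology
open scoped ENNReal

namespace Malliavin

variable {Ω : Type*} [mΩ : MeasurableSpace Ω] {P : Measure Ω}
  {H : Type*} [NormedAddCommGroup H] [InnerProductSpace ℝ H] {H₁ : Submodule ℝ (Lp ℝ 2 P)}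

/-! If `φ' = ψ`, the chain rule gives `D φ(F) = ψ(F) DF`, and pairing with `u = DF / ‖DF‖²` leaves
exactly `ψ(F)`. Duality then reads `E[ψ(F)] = E[φ(F) δ(u)]`. Writing `φ(F)` as the integral of `ψ`
over `y < F` and applying Fubini turns the right side into `∫ ψ p`, so `p` is the density of `F`. An
absolutely continuous law has no atoms, which makes `p` continuous; nonnegativity a.e. then holds
everywhere, and `|p| ≤ E|δ(u)|`.

The main work is the chain rule `HasMalliavinDeriv.comp`: `D` is given on polynomials, while `φ` has
no uniform polynomial approximation on the whole line. Trigonometric functionals of the `W h`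
(`TrigPair`) serve as an intermediate class. They are bounded with bounded derivatives and form an
algebra, so on their range the Weierstrass theorem applies. They lie in the closed graph by Taylor
expansion and Gaussian exponential moments (`derivPair_cos`), and they are dense in it
(`HasMalliavinDeriv.mem_closure_trigPair`).

The other two ingredients are the existence of `δ(u)` by Hahn–Banach and Riesz
(`exists_hasDivergence`) and the passage from integration by parts to a density
(`map_eq_withDensity_tailIntegral`). Everything is phrased for pairs in the closed graph, so
closability never enters. -/

/-- The graph of the derivative on polynomial random variables, as a linear subspace. -/
noncomputable def polynomialSubmodule (W : H ≃ₗᵢ[ℝ] H₁) : Submodule ℝ (Lp ℝ 2 P × Lp H 2 P) where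
  carrier := polynomialGraph W
  zero_mem' := by
    refine ⟨0, 0, Fin.elim0, ?_, ?_⟩
    · simpa using! Lp.coeFn_zero ℝ 2 P
    · simpa using! Lp.coeFn_zero H 2 P
  add_mem' := by
    rintro ⟨F, G⟩ ⟨F', G'⟩ ⟨m, p, h, hF, hG⟩ ⟨m', p', h', hF', hG'⟩
    -- The two polynomials are placed on disjoint blocks of variables, so the cross derivatives
    -- vanish.
    have hl : ∀ i q, MvPolynomial.pderiv (Fin.castAdd m' i)
        (MvPolynomial.rename (Fin.castAdd m') q : MvPolynomial (Fin (m + m')) ℝ) =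
          MvPolynomial.rename (Fin.castAdd m') (MvPolynomial.pderiv i q) := fun i q =>
      MvPolynomial.pderiv_rename (Fin.castAdd_injective m m') i q
    have hr : ∀ i q, MvPolynomial.pderiv (Fin.natAdd m i)
        (MvPolynomial.rename (Fin.natAdd m) q : MvPolynomial (Fin (m + m')) ℝ) =
          MvPolynomial.rename (Fin.natAdd m) (MvPolynomial.pderiv i q) := fun i q =>
      MvPolynomial.pderiv_rename (Fin.natAdd_injective m' m) i q
    have hlr : ∀ (i : Fin m) (q : MvPolynomial (Fin m') ℝ), MvPolynomial.pderiv (Fin.castAdd m' i)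
        (MvPolynomial.rename (Fin.natAdd m) q : MvPolynomial (Fin (m + m')) ℝ) = 0 := by
      intro i q
      induction q using MvPolynomial.induction_on with
      | C a => simp
      | add p q hp hq => simp [hp, hq]
      | mul_X p j hp =>
        rw [map_mul, MvPolynomial.pderiv_mul, hp, MvPolynomial.rename_X, MvPolynomial.pderiv_X_of_ne]
        · simp
        · simp [Fin.ext_iff]; omega
    have hrl : ∀ (i : Fin m') (q : MvPolynomial (Fin m) ℝ), MvPolynomial.pderiv (Fin.natAdd m i)
        (MvPolynomial.rename (Fin.castAdd m') q : MvPolynomial (Fin (m + m')) ℝ) = 0 := by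
      intro i q
      induction q using MvPolynomial.induction_on with
      | C a => simp
      | add p q hp hq => simp [hp, hq]
      | mul_X p j hp =>
        rw [map_mul, MvPolynomial.pderiv_mul, hp, MvPolynomial.rename_X, MvPolynomial.pderiv_X_of_ne]
        · simp
        · simp [Fin.ext_iff]; omega
    refine ⟨m + m', MvPolynomial.rename (Fin.castAdd m') p + MvPolynomial.rename (Fin.natAdd m) p',
      Fin.append h h', ?_, ?_⟩
    · filter_upwards [Lp.coeFn_add F F', hF, hF'] with ω h1 h2 h3
      simp only [Prod.mk_add_mk, h1, Pi.add_apply, map_add, MvPolynomial.eval_rename]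
      simp only [h2, h3, Function.comp_def, Fin.append_left, Fin.append_right]
    · filter_upwards [Lp.coeFn_add G G', hG, hG'] with ω h1 h2 h3
      simp only [Prod.mk_add_mk, h1, Pi.add_apply, map_add, Fin.sum_univ_add, hl, hr, hlr, hrl,
        MvPolynomial.eval_rename, map_zero, zero_add, add_zero]
      simp only [h2, h3, Function.comp_def, Fin.append_left, Fin.append_right]
  smul_mem' := by
    rintro c ⟨F, G⟩ ⟨m, p, h, hF, hG⟩
    refine ⟨m, MvPolynomial.C c * p, h, ?_, ?_⟩
    · filter_upwards [Lp.coeFn_smul c F, hF] with ω h1 h2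
      simp only [Prod.smul_mk, h1, Pi.smul_apply, map_mul, MvPolynomial.eval_C, smul_eq_mul]
      simp only [h2]
    · filter_upwards [Lp.coeFn_smul c G, hG] with ω h1 h2
      simp only [Prod.smul_mk, h1, Pi.smul_apply, MvPolynomial.pderiv_C_mul, map_mul,
        MvPolynomial.eval_C, mul_smul, ← Finset.smul_sum]
      simp only [h2]

/-- The graph of the Malliavin derivative. -/
noncomputable def malliavinGraph (W : H ≃ₗᵢ[ℝ] H₁) : Submodule ℝ (Lp ℝ 2 P × Lp H 2 P) :=
  (polynomialSubmodule W).topologicalClosure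

/-- The functions `f` and `g` represent a pair in the graph of the Malliavin derivative. -/
def DerivPair (W : H ≃ₗᵢ[ℝ] H₁) (f : Ω → ℝ) (g : Ω → H) : Prop :=
  ∃ F G, HasMalliavinDeriv W F G ∧ (F : Ω → ℝ) =ᵐ[P] f ∧ (G : Ω → H) =ᵐ[P] g

namespace DerivPair

variable {W : H ≃ₗᵢ[ℝ] H₁} {f f' : Ω → ℝ} {g g' : Ω → H}

theorem congr (h : DerivPair W f g) (hf : f =ᵐ[P] f') (hg : g =ᵐ[P] g') : DerivPair W f' g' := by
  obtain ⟨F, G, hFG, hF, hG⟩ := h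
  exact ⟨F, G, hFG, hF.trans hf, hG.trans hg⟩

theorem memLp (h : DerivPair W f g) : MemLp f 2 P := by
  obtain ⟨F, G, hFG, hF, hG⟩ := h
  exact (Lp.memLp F).ae_eq hF

theorem memLp_deriv (h : DerivPair W f g) : MemLp g 2 P := by
  obtain ⟨F, G, hFG, hF, hG⟩ := h
  exact (Lp.memLp G).ae_eq hG

theorem add (h : DerivPair W f g) (h' : DerivPair W f' g') :
    DerivPair W (fun ω => f ω + f' ω) (fun ω => g ω + g' ω) := by
  obtain ⟨F, G, hFG, hF, hG⟩ := h
  obtain ⟨F', G', hFG', hF', hG'⟩ := h'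
  exact ⟨F + F', G + G', (malliavinGraph W).add_mem hFG hFG',
    (Lp.coeFn_add F F').trans (hF.add hF'), (Lp.coeFn_add G G').trans (hG.add hG')⟩

theorem smul (c : ℝ) (h : DerivPair W f g) :
    DerivPair W (fun ω => c * f ω) (fun ω => c • g ω) := by
  obtain ⟨F, G, hFG, hF, hG⟩ := h
  exact ⟨c • F, c • G, (malliavinGraph W).smul_mem c hFG,
    (Lp.coeFn_smul c F).trans (hF.const_smul c), (Lp.coeFn_smul c G).trans (hG.const_smul c)⟩

end DerivPair

/-! ### Closedness of the graph and passage to the limit in `L²` -/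

theorem isClosed_malliavinGraph (W : H ≃ₗᵢ[ℝ] H₁) :
    IsClosed (malliavinGraph W : Set (Lp ℝ 2 P × Lp H 2 P)) :=
  (polynomialSubmodule W).isClosed_topologicalClosure

theorem tendsto_eLpNorm_two_of_dominated {E : Type*} [NormedAddCommGroup E]
    {f : ℕ → Ω → E} {f' : Ω → E} {D : Ω → ℝ}
    (hf : ∀ n, AEStronglyMeasurable (f n) P) (hD : MemLp D 2 P)
    (hbd : ∀ n, ∀ᵐ ω ∂P, ‖f n ω‖ ≤ D ω)
    (hlim : ∀ᵐ ω ∂P, Tendsto (fun n => f n ω) atTop (𝓝 (f' ω))) :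
    Tendsto (fun n => eLpNorm (f n - f') 2 P) atTop (𝓝 0) := by
  have hf' : AEStronglyMeasurable f' P := aestronglyMeasurable_of_tendsto_ae _ hf hlim
  have hbd' : ∀ᵐ ω ∂P, ‖f' ω‖ ≤ D ω := by
    filter_upwards [hlim, ae_all_iff.2 hbd] with ω h1 h2
    exact le_of_tendsto h1.norm (Eventually.of_forall h2)
  have key : Tendsto (fun n => ∫⁻ ω, ‖(f n - f') ω‖ₑ ^ (2 : ℝ) ∂P) atTop (𝓝 (∫⁻ _, 0 ∂P)) := by
    refine tendsto_lintegral_of_dominated_convergence' (fun ω => ‖(2 : ℝ) • D ω‖ₑ ^ (2 : ℝ))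
      (fun n => ((hf n).sub hf').enorm.pow_const _) (fun n => ?_) ?_ ?_
    · filter_upwards [hbd n, hbd'] with ω h1 h2
      gcongr
      rw [enorm_le_iff_norm_le, norm_smul, Real.norm_ofNat, Pi.sub_apply]
      calc ‖f n ω - f' ω‖ ≤ ‖f n ω‖ + ‖f' ω‖ := norm_sub_le _ _
        _ ≤ 2 * ‖D ω‖ := by
          have := le_abs_self (D ω)
          rw [Real.norm_eq_abs]; linarith
    · have := (hD.const_smul (2 : ℝ)).eLpNorm_lt_top
      have h2 := lintegral_rpow_enorm_lt_top_of_eLpNorm_lt_top (two_ne_zero) (by simp) this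
      simpa using h2.ne
    · filter_upwards [hlim] with ω h1
      have h3 : Tendsto (fun n => ‖f n ω - f' ω‖ₑ) atTop (𝓝 0) := by
        have := (tendsto_sub_nhds_zero_iff.2 h1).enorm
        simpa using this
      have := (ENNReal.continuous_rpow_const (y := 2)).tendsto (0 : ℝ≥0∞) |>.comp h3
      simpa [Function.comp_def] using this
  have h4 := (ENNReal.continuous_rpow_const (y := 1 / 2)).tendsto (0 : ℝ≥0∞)
  rw [lintegral_zero] at key
  have h5 := h4.comp key
  rw [ENNReal.zero_rpow_of_pos (by norm_num)] at h5
  refine h5.congr fun n => ?_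
  rw [eLpNorm_eq_lintegral_rpow_enorm_toReal two_ne_zero (by simp)]
  simp

theorem DerivPair.of_tendsto {W : H ≃ₗᵢ[ℝ] H₁} {f : ℕ → Ω → ℝ} {g : ℕ → Ω → H} {f' : Ω → ℝ}
    {g' : Ω → H} (h : ∀ n, DerivPair W (f n) (g n)) (hf' : MemLp f' 2 P) (hg' : MemLp g' 2 P)
    (hf : Tendsto (fun n => eLpNorm (f n - f') 2 P) atTop (𝓝 0))
    (hg : Tendsto (fun n => eLpNorm (g n - g') 2 P) atTop (𝓝 0)) : DerivPair W f' g' := by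
  choose F G hFG hF hG using h
  refine ⟨hf'.toLp, hg'.toLp, ?_, hf'.coeFn_toLp, hg'.coeFn_toLp⟩
  refine (isClosed_malliavinGraph W).mem_of_tendsto (b := atTop) (f := fun n => (F n, G n))
    (Tendsto.prodMk_nhds ?_ ?_) (Eventually.of_forall hFG)
  · rw [Lp.tendsto_Lp_iff_tendsto_eLpNorm']
    refine hf.congr fun n => eLpNorm_congr_ae ?_
    exact ((hF n).sub hf'.coeFn_toLp).symm
  · rw [Lp.tendsto_Lp_iff_tendsto_eLpNorm']
    refine hg.congr fun n => eLpNorm_congr_ae ?_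
    exact ((hG n).sub hg'.coeFn_toLp).symm

theorem DerivPair.of_dominated {W : H ≃ₗᵢ[ℝ] H₁} {f : ℕ → Ω → ℝ} {g : ℕ → Ω → H} {f' : Ω → ℝ}
    {g' : Ω → H} {D D' : Ω → ℝ} (h : ∀ n, DerivPair W (f n) (g n)) (hD : MemLp D 2 P)
    (hD' : MemLp D' 2 P) (hfD : ∀ n, ∀ᵐ ω ∂P, ‖f n ω‖ ≤ D ω) (hgD : ∀ n, ∀ᵐ ω ∂P, ‖g n ω‖ ≤ D' ω)
    (hf : ∀ᵐ ω ∂P, Tendsto (fun n => f n ω) atTop (𝓝 (f' ω)))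
    (hg : ∀ᵐ ω ∂P, Tendsto (fun n => g n ω) atTop (𝓝 (g' ω))) : DerivPair W f' g' := by
  have hfm := fun n => (h n).memLp.aestronglyMeasurable
  have hgm := fun n => (h n).memLp_deriv.aestronglyMeasurable
  refine .of_tendsto h ?_ ?_ (tendsto_eLpNorm_two_of_dominated hfm hD hfD hf)
    (tendsto_eLpNorm_two_of_dominated hgm hD' hgD hg)
  · refine hD.mono' (aestronglyMeasurable_of_tendsto_ae _ hfm hf) ?_
    filter_upwards [hf, ae_all_iff.2 hfD] with ω h1 h2
    exact le_of_tendsto h1.norm (Eventually.of_forall h2)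
  · refine hD'.mono' (aestronglyMeasurable_of_tendsto_ae _ hgm hg) ?_
    filter_upwards [hg, ae_all_iff.2 hgD] with ω h1 h2
    exact le_of_tendsto h1.norm (Eventually.of_forall h2)

/-! ### Taylor expansion of the cosine -/

/-- The Taylor coefficients of `x ↦ cos (x + c)` at `0`. -/
noncomputable def cosCoeff (c : ℝ) (k : ℕ) : ℝ :=
  Real.cos (c + k * (Real.pi / 2)) / k.factorial

/-- Differentiating the cosine shifts its phase by `π/2`, so the family indexed by `c` is stable
under differentiation and also covers the sine. -/
theorem cosCoeff_succ (c : ℝ) (k : ℕ) :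
    cosCoeff c (k + 1) * (k + 1) = cosCoeff (c + Real.pi / 2) k := by
  have : ((k.factorial : ℕ) : ℝ) ≠ 0 := by positivity
  have h2 : (k : ℝ) + 1 ≠ 0 := by positivity
  rw [cosCoeff, cosCoeff, Nat.factorial_succ]
  push_cast
  rw [show c + (k + 1) * (Real.pi / 2) = c + Real.pi / 2 + k * (Real.pi / 2) by ring]
  field_simp

theorem hasSum_cosCoeff (c x : ℝ) :
    HasSum (fun k => cosCoeff c k * x ^ k) (Real.cos (x + c)) := by
  have h1 := NormedSpace.expSeries_div_hasSum_exp (𝔸 := ℂ) (x * Complex.I)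
  rw [← Complex.exp_eq_exp_ℂ] at h1
  have h2 := Complex.hasSum_re (h1.mul_left (Complex.exp (c * Complex.I)))
  rw [← Complex.exp_add] at h2
  have e1 : ((c : ℂ) * Complex.I + x * Complex.I) = ((x + c : ℝ) : ℂ) * Complex.I := by
    push_cast; ring
  rw [e1, Complex.exp_ofReal_mul_I_re] at h2
  refine h2.congr_fun fun k => ?_
  have e2 : Complex.exp (c * Complex.I) * ((x * Complex.I) ^ k / (k.factorial : ℂ)) =
      ((x ^ k / k.factorial : ℝ) : ℂ) *
        Complex.exp (((c + k * (Real.pi / 2) : ℝ) : ℂ) * Complex.I) := by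
    have e3 : Complex.I ^ k = Complex.exp (((k * (Real.pi / 2) : ℝ) : ℂ) * Complex.I) := by
      conv_lhs => rw [← Complex.exp_pi_div_two_mul_I, ← Complex.exp_nat_mul]
      congr 1
      push_cast; ring
    rw [mul_pow, e3]
    push_cast
    rw [add_mul (c : ℂ), Complex.exp_add]
    ring
  rw [e2, Complex.re_ofReal_mul, Complex.exp_ofReal_mul_I_re, cosCoeff]
  ring

/-- The bound is uniform in `n` and provides the dominating function for the Taylor sums. -/
theorem abs_sum_cosCoeff_le (c x : ℝ) (n : ℕ) :
    |∑ k ∈ Finset.range n, cosCoeff c k * x ^ k| ≤ Real.exp |x| := by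
  calc |∑ k ∈ Finset.range n, cosCoeff c k * x ^ k|
      ≤ ∑ k ∈ Finset.range n, |cosCoeff c k * x ^ k| := Finset.abs_sum_le_sum_abs _ _
    _ ≤ ∑ k ∈ Finset.range n, |x| ^ k / k.factorial := by
      refine Finset.sum_le_sum fun k _ => ?_
      rw [abs_mul, cosCoeff, abs_div, abs_pow, Nat.abs_cast, div_mul_eq_mul_div]
      gcongr
      exact mul_le_of_le_one_left (by positivity) (Real.abs_cos_le_one _)
    _ ≤ Real.exp |x| := Real.sum_le_exp_of_nonneg (abs_nonneg x) n

/-! ### Exponential moments -/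

theorem IsGaussianHilbertSpace.integrable_exp_mul (hH₁ : IsGaussianHilbertSpace H₁)
    {ξ : Lp ℝ 2 P} (hξ : ξ ∈ H₁) (t : ℝ) : Integrable (fun ω => Real.exp (t * ξ ω)) P := by
  obtain ⟨v, hv⟩ := hH₁.gaussian ξ hξ
  have h := integrable_exp_mul_gaussianReal (μ := 0) (v := v) t
  rw [← hv] at h
  exact (integrable_map_measure h.aestronglyMeasurable
    (Lp.aestronglyMeasurable ξ).aemeasurable).1 h

/-- The square `exp (2t|ξ|)` is at most `exp (2tξ) + exp (-2tξ)`. -/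
theorem IsGaussianHilbertSpace.memLp_exp_mul_abs (hH₁ : IsGaussianHilbertSpace H₁)
    {ξ : Lp ℝ 2 P} (hξ : ξ ∈ H₁) (t : ℝ) : MemLp (fun ω => Real.exp (t * |ξ ω|)) 2 P := by
  have hm := (Lp.aestronglyMeasurable ξ)
  have hm' : AEStronglyMeasurable (fun ω => Real.exp (t * |ξ ω|)) P :=
    (by fun_prop : Continuous fun x : ℝ => Real.exp (t * |x|)).comp_aestronglyMeasurable hm
  rw [memLp_two_iff_integrable_sq hm']
  refine ((hH₁.integrable_exp_mul hξ (2 * t)).add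
    (hH₁.integrable_exp_mul hξ (-(2 * t)))).mono' (hm'.pow 2) (Eventually.of_forall fun ω => ?_)
  rw [Real.norm_eq_abs, abs_of_nonneg (by positivity), ← Real.exp_nat_mul, Pi.add_apply]
  have h1 := (Real.exp_pos (2 * t * ξ ω)).le
  have h2 := (Real.exp_pos (-(2 * t) * ξ ω)).le
  rcases abs_cases (ξ ω) with ⟨h, -⟩ | ⟨h, -⟩
  · rw [h]
    refine le_trans (le_of_eq ?_) (le_add_of_nonneg_right h2)
    congr 1; push_cast; ring
  · rw [h]
    refine le_trans (le_of_eq ?_) (le_add_of_nonneg_left h1)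
    congr 1; push_cast; ring

/-- The sum is at most `m` times its largest term, so one-dimensional exponential moments suffice
and no joint law is needed. -/
theorem IsGaussianHilbertSpace.memLp_exp_sum_abs [IsFiniteMeasure P]
    (hH₁ : IsGaussianHilbertSpace H₁)
    {m : ℕ} {ξ : Fin m → Lp ℝ 2 P} (hξ : ∀ i, ξ i ∈ H₁) (n : ℕ) :
    MemLp (fun ω => Real.exp (n * ∑ i, |ξ i ω|)) 2 P := by
  have h : MemLp (fun ω => 1 + ∑ i, Real.exp ((n * m : ℝ) * |ξ i ω|)) 2 P :=
    (memLp_const (1 : ℝ)).add (memLp_finsetSum _ fun i _ => hH₁.memLp_exp_mul_abs (hξ i) _)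
  have hm : AEStronglyMeasurable (fun ω => ∑ i, |ξ i ω|) P :=
    Finset.aestronglyMeasurable_fun_sum _ fun i _ => (Lp.aestronglyMeasurable (ξ i)).norm
  refine h.mono' ((by fun_prop : Continuous fun x : ℝ =>
    Real.exp (n * x)).comp_aestronglyMeasurable hm) (Eventually.of_forall fun ω => ?_)
  rw [Real.norm_eq_abs, abs_of_pos (Real.exp_pos _)]
  rcases Nat.eq_zero_or_pos m with rfl | hm0
  · simp
  · obtain ⟨j, -, hj⟩ := Finset.exists_max_image Finset.univ (fun i => |ξ i ω|) ⟨⟨0, hm0⟩, by simp⟩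
    calc Real.exp (n * ∑ i, |ξ i ω|) ≤ Real.exp (n * ∑ _i : Fin m, |ξ j ω|) := by
          refine Real.exp_le_exp.2 (mul_le_mul_of_nonneg_left ?_ n.cast_nonneg)
          exact Finset.sum_le_sum hj
      _ = Real.exp ((n * m : ℝ) * |ξ j ω|) := by simp [mul_assoc]
      _ ≤ ∑ i, Real.exp ((n * m : ℝ) * |ξ i ω|) :=
          Finset.single_le_sum (f := fun i => Real.exp ((n * m : ℝ) * |ξ i ω|))
            (fun i _ => (Real.exp_pos _).le) (Finset.mem_univ j)
      _ ≤ _ := by linarith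

/-- The bound increases with each `|y i|`, so it remains valid when the variables are replaced by
truncations of smaller modulus. -/
theorem exists_abs_eval_le_exp {m : ℕ} (p : MvPolynomial (Fin m) ℝ) :
    ∃ (C : ℝ) (n : ℕ), 0 ≤ C ∧ ∀ y : Fin m → ℝ,
      |MvPolynomial.eval y p| ≤ C * Real.exp (n * ∑ i, |y i|) := by
  induction p using MvPolynomial.induction_on with
  | C a => exact ⟨|a|, 0, abs_nonneg a, fun y => by simp⟩
  | add p q hp hq =>
    obtain ⟨C, n, hC, h⟩ := hp
    obtain ⟨C', n', hC', h'⟩ := hq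
    refine ⟨C + C', n + n', add_nonneg hC hC', fun y => ?_⟩
    have hs : 0 ≤ ∑ i, |y i| := Finset.sum_nonneg fun i _ => abs_nonneg _
    rw [map_add, add_mul]
    refine (abs_add_le _ _).trans (add_le_add ((h y).trans ?_) ((h' y).trans ?_)) <;>
    · gcongr
      linarith [Nat.cast_nonneg (α := ℝ) n, Nat.cast_nonneg (α := ℝ) n']
  | mul_X p j hp =>
    obtain ⟨C, n, hC, h⟩ := hp
    refine ⟨C, n + 1, hC, fun y => ?_⟩
    have hj : |y j| ≤ ∑ i, |y i| :=
      Finset.single_le_sum (f := fun i => |y i|) (fun i _ => abs_nonneg _) (Finset.mem_univ j)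
    have hj' : |y j| ≤ Real.exp (∑ i, |y i|) := by linarith [Real.add_one_le_exp (∑ i, |y i|)]
    rw [map_mul, MvPolynomial.eval_X, abs_mul]
    push_cast
    rw [add_mul, one_mul, Real.exp_add, ← mul_assoc]
    exact mul_le_mul (h y) hj' (abs_nonneg _) (by positivity)

/-! ### Trigonometric functionals -/

/-- The derivative has one term fewer because the constant term disappears. -/
theorem derivPair_sum_cosCoeff (hH₁ : IsGaussianHilbertSpace H₁) (W : H ≃ₗᵢ[ℝ] H₁) (h : H) (c : ℝ)
    (n : ℕ) :
    DerivPair W (fun ω => ∑ k ∈ Finset.range (n + 1), cosCoeff c k * (W h : Lp ℝ 2 P) ω ^ k)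
      (fun ω => (∑ k ∈ Finset.range n,
        cosCoeff (c + Real.pi / 2) k * (W h : Lp ℝ 2 P) ω ^ k) • h) := by
  have hexp := hH₁.memLp_exp_mul_abs (W h).2 1
  have hmeas : ∀ c n, AEStronglyMeasurable
      (fun ω => ∑ k ∈ Finset.range n, cosCoeff c k * (W h : Lp ℝ 2 P) ω ^ k) P := fun c n =>
    (by fun_prop : Continuous fun x : ℝ => ∑ k ∈ Finset.range n, cosCoeff c k * x ^ k)
      |>.comp_aestronglyMeasurable (Lp.aestronglyMeasurable _)
  have hL : ∀ c n, MemLp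
      (fun ω => ∑ k ∈ Finset.range n, cosCoeff c k * (W h : Lp ℝ 2 P) ω ^ k) 2 P := fun c n =>
    hexp.mono' (hmeas c n) (Eventually.of_forall fun ω => by
      rw [one_mul]; exact abs_sum_cosCoeff_le _ _ _)
  have hL' : MemLp (fun ω => (∑ k ∈ Finset.range n,
      cosCoeff (c + Real.pi / 2) k * (W h : Lp ℝ 2 P) ω ^ k) • h) 2 P := by
    refine ((hL (c + Real.pi / 2) n).norm.mul_const ‖h‖).mono'
      ((hmeas _ _).smul_const h) (Eventually.of_forall fun ω => ?_)
    rw [norm_smul]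
  refine ⟨(hL c (n + 1)).toLp, hL'.toLp, subset_closure ⟨1, ∑ k ∈ Finset.range (n + 1),
    MvPolynomial.C (cosCoeff c k) * MvPolynomial.X 0 ^ k, fun _ => h, ?_, ?_⟩,
    MemLp.coeFn_toLp _, MemLp.coeFn_toLp _⟩
  · refine (hL c (n + 1)).coeFn_toLp.trans (Eventually.of_forall fun ω => ?_)
    simp [map_sum]
  · refine hL'.coeFn_toLp.trans (Eventually.of_forall fun ω => ?_)
    simp only [Fin.sum_univ_one, map_sum, MvPolynomial.pderiv_C_mul, MvPolynomial.pderiv_pow,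
      MvPolynomial.pderiv_X_self, map_mul, MvPolynomial.eval_C, map_pow, MvPolynomial.eval_X,
      map_natCast, map_one, mul_one]
    congr 1
    rw [Finset.sum_range_succ']
    simp only [Nat.cast_zero, zero_mul, mul_zero, add_zero, Nat.add_sub_cancel]
    refine Finset.sum_congr rfl fun k _ => ?_
    rw [← cosCoeff_succ]
    push_cast
    ring

theorem derivPair_cos (hH₁ : IsGaussianHilbertSpace H₁) (W : H ≃ₗᵢ[ℝ] H₁) (h : H) (c : ℝ) :
    DerivPair W (fun ω => Real.cos ((W h : Lp ℝ 2 P) ω + c))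
      (fun ω => (-Real.sin ((W h : Lp ℝ 2 P) ω + c)) • h) := by
  have hexp := hH₁.memLp_exp_mul_abs (W h).2 1
  refine .of_dominated (fun n => derivPair_sum_cosCoeff hH₁ W h c n) hexp (hexp.mul_const ‖h‖)
    (fun n => Eventually.of_forall fun ω => ?_) (fun n => Eventually.of_forall fun ω => ?_)
    (Eventually.of_forall fun ω => ?_) (Eventually.of_forall fun ω => ?_)
  · rw [one_mul]; exact abs_sum_cosCoeff_le _ _ _
  · rw [one_mul, norm_smul]
    gcongr
    exact abs_sum_cosCoeff_le _ _ _
  · exact (hasSum_cosCoeff c _).tendsto_sum_nat.comp (tendsto_add_atTop_nat 1)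
  · rw [← Real.cos_add_pi_div_two, add_assoc]
    exact (hasSum_cosCoeff _ _).tendsto_sum_nat.smul_const h

/-- Pairs `(f, g)`, where `f` is a trigonometric polynomial in the Gaussian variables `W h`, and
`g` its derivative. -/
inductive TrigPair (W : H ≃ₗᵢ[ℝ] H₁) : (Ω → ℝ) → (Ω → H) → Prop
  | cos (h : H) (c : ℝ) : TrigPair W (fun ω => Real.cos ((W h : Lp ℝ 2 P) ω + c))
      (fun ω => (-Real.sin ((W h : Lp ℝ 2 P) ω + c)) • h)
  | add {f f' : Ω → ℝ} {g g' : Ω → H} : TrigPair W f g → TrigPair W f' g' →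
      TrigPair W (fun ω => f ω + f' ω) (fun ω => g ω + g' ω)
  | smul (c : ℝ) {f : Ω → ℝ} {g : Ω → H} : TrigPair W f g →
      TrigPair W (fun ω => c * f ω) (fun ω => c • g ω)
  -- Required because identities such as `W (h + k) = W h + W k` hold pointwise only almost surely.
  | congr {f f' : Ω → ℝ} {g g' : Ω → H} : TrigPair W f g → f =ᵐ[P] f' → g =ᵐ[P] g' →
      TrigPair W f' g'

namespace TrigPair

variable {W : H ≃ₗᵢ[ℝ] H₁} {f f' : Ω → ℝ} {g g' : Ω → H}

theorem derivPair (hH₁ : IsGaussianHilbertSpace H₁) (h : TrigPair W f g) : DerivPair W f g := by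
  induction h with
  | cos h c => exact derivPair_cos hH₁ W h c
  | add _ _ h h' => exact h.add h'
  | smul c _ h => exact h.smul c
  | congr _ hf hg h => exact h.congr hf hg

theorem bounded (h : TrigPair W f g) :
    ∃ C, (∀ᵐ ω ∂P, |f ω| ≤ C) ∧ ∀ᵐ ω ∂P, ‖g ω‖ ≤ C := by
  induction h with
  | cos h c =>
    refine ⟨1 + ‖h‖, Eventually.of_forall fun ω => ?_, Eventually.of_forall fun ω => ?_⟩
    · exact (Real.abs_cos_le_one _).trans (by simp)
    · rw [norm_smul, norm_neg, Real.norm_eq_abs]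
      have := mul_le_of_le_one_left (norm_nonneg h)
        (Real.abs_sin_le_one ((W h : Lp ℝ 2 P) ω + c))
      linarith
  | add _ _ h h' =>
    obtain ⟨C, h1, h2⟩ := h
    obtain ⟨C', h1', h2'⟩ := h'
    refine ⟨C + C', ?_, ?_⟩
    · filter_upwards [h1, h1'] with ω a b using (abs_add_le _ _).trans (add_le_add a b)
    · filter_upwards [h2, h2'] with ω a b using (norm_add_le _ _).trans (add_le_add a b)
  | smul c _ h =>
    obtain ⟨C, h1, h2⟩ := h
    refine ⟨|c| * C, ?_, ?_⟩
    · filter_upwards [h1] with ω a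
      rw [abs_mul]; gcongr
    · filter_upwards [h2] with ω a
      rw [norm_smul, Real.norm_eq_abs]; gcongr
  | congr _ hf hg h =>
    obtain ⟨C, h1, h2⟩ := h
    refine ⟨C, ?_, ?_⟩
    · filter_upwards [h1, hf] with ω a b using b ▸ a
    · filter_upwards [h2, hg] with ω a b using b ▸ a

theorem const (W : H ≃ₗᵢ[ℝ] H₁) (a : ℝ) : TrigPair W (fun _ => a) (fun _ => 0) := by
  refine ((TrigPair.cos (W := W) 0 0).smul a).congr ?_ ?_
  · rw [map_zero, ZeroMemClass.coe_zero]
    filter_upwards [Lp.coeFn_zero ℝ 2 P] with ω hω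
    rw [hω]
    simp
  · exact Eventually.of_forall fun ω => by simp

theorem cos_mul_cos (W : H ≃ₗᵢ[ℝ] H₁) (h k : H) (c d : ℝ) :
    TrigPair W (fun ω => Real.cos ((W h : Lp ℝ 2 P) ω + c) * Real.cos ((W k : Lp ℝ 2 P) ω + d))
      (fun ω => Real.cos ((W h : Lp ℝ 2 P) ω + c) • (-Real.sin ((W k : Lp ℝ 2 P) ω + d)) • k +
        Real.cos ((W k : Lp ℝ 2 P) ω + d) • (-Real.sin ((W h : Lp ℝ 2 P) ω + c)) • h) := by
  have hs : ∀ᵐ ω ∂P, (W (h + k) : Lp ℝ 2 P) ω = (W h : Lp ℝ 2 P) ω + (W k : Lp ℝ 2 P) ω := by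
    rw [map_add, Submodule.coe_add]
    exact Lp.coeFn_add _ _
  have hd : ∀ᵐ ω ∂P, (W (h - k) : Lp ℝ 2 P) ω = (W h : Lp ℝ 2 P) ω - (W k : Lp ℝ 2 P) ω := by
    rw [map_sub, Submodule.coe_sub]
    exact Lp.coeFn_sub _ _
  refine (((TrigPair.cos (W := W) (h + k) (c + d)).add
    (TrigPair.cos (W := W) (h - k) (c - d))).smul (1 / 2)).congr ?_ ?_
  · filter_upwards [hs, hd] with ω h1 h2
    rw [h1, h2, add_add_add_comm, ← add_sub_add_comm, Real.cos_add, Real.cos_sub]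
    ring
  · filter_upwards [hs, hd] with ω h1 h2
    rw [h1, h2, add_add_add_comm, ← add_sub_add_comm, Real.sin_add, Real.sin_sub]
    module

/-- Both sides are bilinear, which reduces the claim to two cosines, where the product-to-sum
formula applies. -/
theorem mul (h : TrigPair W f g) (h' : TrigPair W f' g') :
    TrigPair W (fun ω => f ω * f' ω) (fun ω => f ω • g' ω + f' ω • g ω) := by
  induction h with
  | cos h c =>
    induction h' with
    | cos k d => exact cos_mul_cos W h k c d
    | add _ _ h h' =>
      exact (h.add h').congr (Eventually.of_forall fun ω => by simp only; ring)
        (Eventually.of_forall fun ω => by simp only; module)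
    | smul a _ h =>
      exact (h.smul a).congr (Eventually.of_forall fun ω => by simp only; ring)
        (Eventually.of_forall fun ω => by simp only; module)
    | congr _ hf hg h =>
      refine h.congr ?_ ?_
      · filter_upwards [hf] with ω a
        rw [a]
      · filter_upwards [hf, hg] with ω a b
        rw [a, b]
  | add _ _ h h' =>
    exact (h.add h').congr (Eventually.of_forall fun ω => by simp only; ring)
      (Eventually.of_forall fun ω => by simp only; module)
  | smul a _ h =>
    exact (h.smul a).congr (Eventually.of_forall fun ω => by simp only; ring)
      (Eventually.of_forall fun ω => by simp only; module)
  | congr _ hf hg h =>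
    refine h.congr ?_ ?_
    · filter_upwards [hf] with ω a
      rw [a]
    · filter_upwards [hf, hg] with ω a b
      rw [a, b]

theorem eval_mvPolynomial {m : ℕ} {f : Fin m → Ω → ℝ} {g : Fin m → Ω → H}
    (h : ∀ i, TrigPair W (f i) (g i)) (p : MvPolynomial (Fin m) ℝ) :
    TrigPair W (fun ω => MvPolynomial.eval (fun i => f i ω) p)
      (fun ω => ∑ i, MvPolynomial.eval (fun j => f j ω) (MvPolynomial.pderiv i p) • g i ω) := by
  induction p using MvPolynomial.induction_on with
  | C a => simpa using const W a
  | add p q hp hq =>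
    refine (hp.add hq).congr ?_ ?_ <;> refine Eventually.of_forall fun ω => ?_
    · simp
    · simp [add_smul, Finset.sum_add_distrib]
  | mul_X p j hp =>
    refine (hp.mul (h j)).congr ?_ ?_ <;> refine Eventually.of_forall fun ω => ?_
    · simp
    · simp only [MvPolynomial.pderiv_mul, map_add, map_mul, MvPolynomial.eval_X, add_smul,
        Finset.sum_add_distrib, Finset.smul_sum]
      rw [add_comm]
      congr 1
      · exact Finset.sum_congr rfl fun i _ => by rw [mul_comm, mul_smul]
      · rw [Finset.sum_eq_single j]
        · simp
        · intro i _ hij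
          simp [MvPolynomial.pderiv_X_of_ne hij.symm]
        · simp

theorem eval_polynomial (h : TrigPair W f g) (q : Polynomial ℝ) :
    TrigPair W (fun ω => q.eval (f ω)) (fun ω => q.derivative.eval (f ω) • g ω) := by
  induction q using Polynomial.induction_on' with
  | add p q hp hq =>
    refine (hp.add hq).congr ?_ ?_ <;> refine Eventually.of_forall fun ω => ?_
    · simp
    · simp [add_smul]
  | monomial n a =>
    have key : TrigPair W (fun ω => f ω ^ n) (fun ω => ((n : ℝ) * f ω ^ (n - 1)) • g ω) := by
      induction n with
      | zero => simpa using const W 1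
      | succ n ih =>
        refine (ih.mul h).congr ?_ ?_ <;> refine Eventually.of_forall fun ω => ?_
        · simp [pow_succ]
        · rcases n with _ | n
          · simp
          · simp only [Nat.add_sub_cancel, Nat.cast_add, Nat.cast_one, pow_succ]
            module
    refine (key.smul a).congr ?_ ?_ <;> refine Eventually.of_forall fun ω => ?_
    · simp [Polynomial.eval_monomial]
    · simp [Polynomial.derivative_monomial, Polynomial.eval_monomial, smul_smul, mul_assoc]

/-- The functional is `(n + 1) sin (W h / (n + 1))`, a bounded substitute for `W h`. The `sinc` form
makes evident both the bound by `|W h|` and the convergence to `W h`. -/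
theorem mul_sinc (W : H ≃ₗᵢ[ℝ] H₁) (h : H) (n : ℕ) :
    TrigPair W (fun ω => (W h : Lp ℝ 2 P) ω * Real.sinc ((W h : Lp ℝ 2 P) ω / (n + 1)))
      (fun ω => Real.cos ((W h : Lp ℝ 2 P) ω / (n + 1)) • h) := by
  have hn : (n : ℝ) + 1 ≠ 0 := by positivity
  have hs : ∀ᵐ ω ∂P, (W (((n : ℝ) + 1)⁻¹ • h) : Lp ℝ 2 P) ω = (W h : Lp ℝ 2 P) ω / (n + 1) := by
    rw [map_smul, Submodule.coe_smul]
    filter_upwards [Lp.coeFn_smul ((n : ℝ) + 1)⁻¹ (W h : Lp ℝ 2 P)] with ω hω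
    rw [hω, Pi.smul_apply, smul_eq_mul, div_eq_inv_mul]
  refine ((TrigPair.cos (W := W) (((n : ℝ) + 1)⁻¹ • h) (-(Real.pi / 2))).smul
    ((n : ℝ) + 1)).congr ?_ ?_
  · filter_upwards [hs] with ω hω
    rw [hω, ← sub_eq_add_neg, Real.cos_sub_pi_div_two]
    rcases eq_or_ne ((W h : Lp ℝ 2 P) ω) 0 with h0 | h0
    · simp [h0]
    · rw [Real.sinc_of_ne_zero (div_ne_zero h0 hn)]
      field_simp
  · filter_upwards [hs] with ω hω
    rw [hω, ← sub_eq_add_neg, Real.sin_sub_pi_div_two, neg_neg, smul_comm,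
      smul_inv_smul₀ hn]

end TrigPair

/-- Trigonometric functionals are dense in the graph of the Malliavin derivative. -/
theorem HasMalliavinDeriv.mem_closure_trigPair [IsFiniteMeasure P]
    (hH₁ : IsGaussianHilbertSpace H₁) {W : H ≃ₗᵢ[ℝ] H₁}
    {F : Lp ℝ 2 P} {G : Lp H 2 P} (hFG : HasMalliavinDeriv W F G) :
    (F, G) ∈ closure {z : Lp ℝ 2 P × Lp H 2 P | TrigPair W z.1 z.2} := by
  refine closure_minimal ?_ isClosed_closure hFG
  clear hFG F G
  rintro ⟨F, G⟩ ⟨m, p, h, hF, hG⟩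
  set X : Fin m → Ω → ℝ := fun i => (W (h i) : Lp ℝ 2 P) with hX
  -- Each Gaussian variable is replaced by its bounded trigonometric substitute; dominated
  -- convergence then recovers the polynomial and its derivative.
  set S : ℕ → Fin m → Ω → ℝ := fun n i ω => X i ω * Real.sinc (X i ω / (n + 1)) with hS
  have hT := fun n => TrigPair.eval_mvPolynomial (fun i => TrigPair.mul_sinc W (h i) n) p
  have hSle : ∀ n i ω, |S n i ω| ≤ |X i ω| := fun n i ω => by
    rw [hS, abs_mul]
    exact mul_le_of_le_one_right (abs_nonneg _) (Real.abs_sinc_le_one _)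
  have hdiv : ∀ x : ℝ, Tendsto (fun n : ℕ => x / ((n : ℝ) + 1)) atTop (𝓝 0) := fun x => by
    simpa [div_eq_mul_inv] using tendsto_one_div_add_atTop_nhds_zero_nat.const_mul x
  have hSlim : ∀ i ω, Tendsto (fun n => S n i ω) atTop (𝓝 (X i ω)) := fun i ω => by
    have := ((Real.continuous_sinc.tendsto 0).comp (hdiv (X i ω))).const_mul (X i ω)
    simpa using this
  have hbd : ∀ q : MvPolynomial (Fin m) ℝ, ∃ D : Ω → ℝ, MemLp D 2 P ∧
      ∀ n ω, |MvPolynomial.eval (fun i => S n i ω) q| ≤ D ω := fun q => by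
    obtain ⟨C, k, hC, hq⟩ := exists_abs_eval_le_exp q
    refine ⟨_, (hH₁.memLp_exp_sum_abs (fun i => (W (h i)).2) k).const_mul C, fun n ω => ?_⟩
    refine (hq _).trans ?_
    refine mul_le_mul_of_nonneg_left (Real.exp_le_exp.2
      (mul_le_mul_of_nonneg_left ?_ k.cast_nonneg)) hC
    exact Finset.sum_le_sum fun i _ => hSle n i ω
  have hlim : ∀ (q : MvPolynomial (Fin m) ℝ) ω,
      Tendsto (fun n => MvPolynomial.eval (fun i => S n i ω) q) atTop
        (𝓝 (MvPolynomial.eval (fun i => X i ω) q)) := fun q ω =>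
    ((MvPolynomial.continuous_eval q).tendsto _).comp (tendsto_pi_nhds.2 fun i => hSlim i ω)
  have hP := fun n => (hT n).derivPair hH₁
  obtain ⟨D, hD, hDle⟩ := hbd p
  choose D' hD' hDle' using fun i => hbd (MvPolynomial.pderiv i p)
  have hL1 := tendsto_eLpNorm_two_of_dominated (fun n => (hP n).memLp.aestronglyMeasurable) hD
    (fun n => Eventually.of_forall (hDle n)) (Eventually.of_forall (hlim p))
  have hL2 := tendsto_eLpNorm_two_of_dominated
    (f' := fun ω => ∑ i, MvPolynomial.eval (fun j => X j ω) (MvPolynomial.pderiv i p) • h i)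
    (fun n => (hP n).memLp_deriv.aestronglyMeasurable)
    (memLp_finsetSum Finset.univ fun i _ => (hD' i).mul_const ‖h i‖)
    (fun n => Eventually.of_forall fun ω => ?_) (Eventually.of_forall fun ω => ?_)
  · refine mem_closure_of_tendsto (b := atTop)
      (f := fun n => ((hP n).memLp.toLp, (hP n).memLp_deriv.toLp)) (Tendsto.prodMk_nhds ?_ ?_)
      (Eventually.of_forall fun n => ?_)
    · rw [Lp.tendsto_Lp_iff_tendsto_eLpNorm']
      exact hL1.congr fun n => eLpNorm_congr_ae ((hP n).memLp.coeFn_toLp.sub hF).symm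
    · rw [Lp.tendsto_Lp_iff_tendsto_eLpNorm']
      exact hL2.congr fun n => eLpNorm_congr_ae ((hP n).memLp_deriv.coeFn_toLp.sub hG).symm
    · exact (hT n).congr (hP n).memLp.coeFn_toLp.symm (hP n).memLp_deriv.coeFn_toLp.symm
  · refine (norm_sum_le _ _).trans (Finset.sum_le_sum fun i _ => ?_)
    rw [norm_smul, norm_smul]
    refine mul_le_mul (hDle' i n ω) ?_ (by positivity) ((abs_nonneg _).trans (hDle' i n ω))
    exact mul_le_of_le_one_left (norm_nonneg _) (Real.abs_cos_le_one _)
  · refine tendsto_finsetSum _ fun i _ => (hlim _ ω).smul ?_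
    have := ((Real.continuous_cos.tendsto 0).comp (hdiv (X i ω))).smul_const (h i)
    simpa using this

/-! ### The chain rule -/

/-- Allows Weierstrass to be applied to `ψ = φ'` and then integrated, which approximates `φ`
together with its derivative. -/
theorem exists_polynomial_derivative_eq (r : Polynomial ℝ) (a : ℝ) :
    ∃ q : Polynomial ℝ, Polynomial.derivative q = r ∧ q.eval 0 = a := by
  obtain ⟨q, hq⟩ : ∃ q : Polynomial ℝ, Polynomial.derivative q = r := by
    induction r using Polynomial.induction_on' with
    | add p q hp hq =>
      obtain ⟨p', rfl⟩ := hp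
      obtain ⟨q', rfl⟩ := hq
      exact ⟨p' + q', by simp⟩
    | monomial n b =>
      refine ⟨Polynomial.monomial (n + 1) (b / (n + 1)), ?_⟩
      have : (n : ℝ) + 1 ≠ 0 := by positivity
      rw [Polynomial.derivative_monomial, Nat.add_sub_cancel]
      push_cast
      rw [div_mul_cancel₀ b this]
  exact ⟨q + Polynomial.C (a - q.eval 0), by simp [hq], by simp⟩

theorem abs_sub_le_of_hasDerivAt {φ ψ : ℝ → ℝ} {M : ℝ} (hφ : ∀ x, HasDerivAt φ (ψ x) x)
    (hM : ∀ x, |ψ x| ≤ M) (x y : ℝ) : |φ y - φ x| ≤ M * |y - x| :=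
  Convex.norm_image_sub_le_of_norm_hasDerivWithin_le (s := Set.univ)
    (fun z _ => (hφ z).hasDerivWithinAt) (fun z _ => hM z) convex_univ trivial trivial

theorem TrigPair.comp [IsFiniteMeasure P] (hH₁ : IsGaussianHilbertSpace H₁) {W : H ≃ₗᵢ[ℝ] H₁}
    {f : Ω → ℝ} {g : Ω → H} (h : TrigPair W f g) {φ ψ : ℝ → ℝ} {M : ℝ}
    (hφ : ∀ x, HasDerivAt φ (ψ x) x) (hψ : Continuous ψ) (hM : ∀ x, |ψ x| ≤ M) :
    DerivPair W (fun ω => φ (f ω)) (fun ω => ψ (f ω) • g ω) := by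
  obtain ⟨R, hf, hg⟩ := h.bounded
  have hM0 : 0 ≤ M := (abs_nonneg _).trans (hM 0)
  have hr : ∀ n : ℕ, ∃ q : Polynomial ℝ, q.eval 0 = φ 0 ∧
      ∀ x ∈ Set.Icc (-R) R, |q.derivative.eval x - ψ x| ≤ 1 / ((n : ℝ) + 1) := fun n => by
    obtain ⟨r, hr⟩ := exists_polynomial_near_of_continuousOn (-R) R ψ hψ.continuousOn
      (1 / ((n : ℝ) + 1)) (by positivity)
    obtain ⟨q, hq, hq0⟩ := exists_polynomial_derivative_eq r (φ 0)
    exact ⟨q, hq0, fun x hx => hq ▸ (hr x hx).le⟩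
  choose q hq0 hq using hr
  have hε1 : ∀ n : ℕ, 1 / ((n : ℝ) + 1) ≤ 1 := fun n =>
    div_le_one_of_le₀ (by linarith [n.cast_nonneg (α := ℝ)]) (by positivity)
  have hq' : ∀ n, ∀ x ∈ Set.Icc (-R) R, |(q n).eval x - φ x| ≤ 1 / ((n : ℝ) + 1) * R := by
    intro n x hx
    -- At `0` the polynomial agrees with `φ`, so the mean value inequality from there bounds the
    -- error.
    have h0 : (0 : ℝ) ∈ Set.Icc (-R) R := by constructor <;> linarith [hx.1, hx.2]
    have := Convex.norm_image_sub_le_of_norm_hasDerivWithin_le (s := Set.Icc (-R) R)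
      (f := fun x => (q n).eval x - φ x) (fun z _ => (((q n).hasDerivAt z).sub
        (hφ z)).hasDerivWithinAt) (fun z hz => hq n z hz) (convex_Icc _ _) h0 hx
    simp only [hq0, sub_self, sub_zero, Real.norm_eq_abs] at this
    refine this.trans ?_
    gcongr
    exact abs_le.2 hx
  refine .of_dominated (fun n => (h.eval_polynomial (q n)).derivPair hH₁)
    (memLp_const (|φ 0| + M * R + R)) (memLp_const ((M + 1) * R)) (fun n => ?_) (fun n => ?_) ?_ ?_
  · filter_upwards [hf] with ω hω
    have h1 := hq' n (f ω) (abs_le.1 hω)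
    have h2 := abs_sub_le_of_hasDerivAt hφ hM 0 (f ω)
    rw [sub_zero] at h2
    have h3 : M * |f ω| ≤ M * R := by gcongr
    have h4 : 1 / ((n : ℝ) + 1) * R ≤ R :=
      mul_le_of_le_one_left ((abs_nonneg _).trans hω) (hε1 n)
    have h5 := abs_sub_abs_le_abs_sub ((q n).eval (f ω)) (φ (f ω))
    have h6 := abs_sub_abs_le_abs_sub (φ (f ω)) (φ 0)
    rw [Real.norm_eq_abs]
    linarith
  · filter_upwards [hf, hg] with ω hω hω'
    have h1 := hq n (f ω) (abs_le.1 hω)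
    have h5 := abs_sub_abs_le_abs_sub ((q n).derivative.eval (f ω)) (ψ (f ω))
    rw [norm_smul, Real.norm_eq_abs]
    gcongr
    linarith [hM (f ω), hε1 n]
  · filter_upwards [hf] with ω hω
    rw [tendsto_iff_norm_sub_tendsto_zero]
    refine squeeze_zero (fun _ => norm_nonneg _) (fun n => hq' n (f ω) (abs_le.1 hω)) ?_
    simpa using tendsto_one_div_add_atTop_nhds_zero_nat.mul_const R
  · filter_upwards [hf] with ω hω
    refine Tendsto.smul_const ?_ _
    rw [tendsto_iff_norm_sub_tendsto_zero]
    exact squeeze_zero (fun _ => norm_nonneg _) (fun n => hq n (f ω) (abs_le.1 hω))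
      tendsto_one_div_add_atTop_nhds_zero_nat

/-- The chain rule for the Malliavin derivative. -/
theorem HasMalliavinDeriv.comp [IsFiniteMeasure P] (hH₁ : IsGaussianHilbertSpace H₁)
    {W : H ≃ₗᵢ[ℝ] H₁} {F : Lp ℝ 2 P} {G : Lp H 2 P} (h : HasMalliavinDeriv W F G)
    {φ ψ : ℝ → ℝ} {M : ℝ} (hφ : ∀ x, HasDerivAt φ (ψ x) x) (hψ : Continuous ψ)
    (hM : ∀ x, |ψ x| ≤ M) :
    DerivPair W (fun ω => φ (F ω)) (fun ω => ψ (F ω) • G ω) := by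
  have hM0 : 0 ≤ M := (abs_nonneg _).trans (hM 0)
  have hφc : Continuous φ := continuous_iff_continuousAt.2 fun x => (hφ x).continuousAt
  obtain ⟨z, hz, hzlim⟩ := mem_closure_iff_seq_limit.1 (h.mem_closure_trigPair hH₁)
  have hzF : Tendsto (fun n => (z n).1) atTop (𝓝 F) := (continuous_fst.tendsto _).comp hzlim
  have hzG : Tendsto (fun n => (z n).2) atTop (𝓝 G) := (continuous_snd.tendsto _).comp hzlim
  -- Since `ψ` is only continuous, convergence of `ψ(Fₙ)` calls for a subsequence converging almost
  -- everywhere.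
  obtain ⟨s, hs, hsF⟩ := (tendstoInMeasure_of_tendsto_Lp hzF).exists_seq_tendsto_ae
  replace hzF := (Lp.tendsto_Lp_iff_tendsto_eLpNorm' _ _).1 (hzF.comp hs.tendsto_atTop)
  replace hzG := (Lp.tendsto_Lp_iff_tendsto_eLpNorm' _ _).1 (hzG.comp hs.tendsto_atTop)
  have hFm := Lp.aestronglyMeasurable F
  have hGm := Lp.aestronglyMeasurable G
  have hψm : ∀ n, AEStronglyMeasurable (fun ω => ψ ((z (s n)).1 ω)) P := fun n =>
    hψ.comp_aestronglyMeasurable (Lp.aestronglyMeasurable _)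
  have hGbd : MemLp (fun ω => M * ‖G ω‖) 2 P := (Lp.memLp G).norm.const_mul M
  have hψbd : ∀ (x : ℝ) (y : H), ‖ψ x • y‖ ≤ M * ‖y‖ := fun x y => by
    rw [norm_smul]
    exact mul_le_mul_of_nonneg_right (hM x) (norm_nonneg y)
  refine .of_tendsto (fun n => TrigPair.comp hH₁ (hz (s n)) hφ hψ hM) ?_ ?_ ?_ ?_
  · refine ((memLp_const |φ 0|).add ((Lp.memLp F).norm.const_mul M)).mono'
      (hφc.comp_aestronglyMeasurable hFm) (Eventually.of_forall fun ω => ?_)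
    have h2 := abs_sub_le_of_hasDerivAt hφ hM 0 (F ω)
    have h6 := abs_sub_abs_le_abs_sub (φ (F ω)) (φ 0)
    rw [sub_zero] at h2
    simp only [Real.norm_eq_abs, Pi.add_apply]
    linarith
  · exact hGbd.mono' ((hψ.comp_aestronglyMeasurable hFm).smul hGm)
      (Eventually.of_forall fun ω => hψbd _ _)
  · have h0 := ENNReal.Tendsto.const_mul (a := ENNReal.ofReal M) hzF (Or.inr ENNReal.ofReal_ne_top)
    rw [mul_zero] at h0
    refine tendsto_of_tendsto_of_tendsto_of_le_of_le tendsto_const_nhds h0 (fun _ => zero_le)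
      fun n => eLpNorm_le_mul_eLpNorm_of_ae_le_mul (Eventually.of_forall fun ω => ?_) 2
    exact abs_sub_le_of_hasDerivAt hφ hM _ _
  -- The difference splits as `ψ(Fₙ)(Gₙ - G) + (ψ(Fₙ) - ψ(F))G`: the first term is small because `ψ`
  -- is bounded, the second by dominated convergence.
  · have h1 : Tendsto (fun n => eLpNorm (fun ω => ψ ((z (s n)).1 ω) •
        (((z (s n)).2 : Ω → H) - G) ω) 2 P) atTop (𝓝 0) := by
      have h0 := ENNReal.Tendsto.const_mul (a := ENNReal.ofReal M) hzG
        (Or.inr ENNReal.ofReal_ne_top)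
      rw [mul_zero] at h0
      refine tendsto_of_tendsto_of_tendsto_of_le_of_le tendsto_const_nhds h0 (fun _ => zero_le)
        fun n => eLpNorm_le_mul_eLpNorm_of_ae_le_mul (Eventually.of_forall fun ω => hψbd _ _) 2
    have h2 : Tendsto (fun n => eLpNorm ((fun ω => ψ ((z (s n)).1 ω) • G ω) -
        fun ω => ψ (F ω) • G ω) 2 P) atTop (𝓝 0) := by
      refine tendsto_eLpNorm_two_of_dominated (fun n => (hψm n).smul hGm) hGbd
        (fun n => Eventually.of_forall fun ω => hψbd _ _) ?_
      filter_upwards [hsF] with ω hω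
      exact ((hψ.tendsto _).comp hω).smul_const _
    have h3 := h1.add h2
    rw [add_zero] at h3
    refine tendsto_of_tendsto_of_tendsto_of_le_of_le tendsto_const_nhds h3 (fun _ => zero_le)
      fun n => ?_
    refine le_trans (le_of_eq ?_) (eLpNorm_add_le
      ((hψm n).smul ((Lp.aestronglyMeasurable _).sub hGm))
      (((hψm n).smul hGm).sub ((hψ.comp_aestronglyMeasurable hFm).smul hGm)) one_le_two)
    congr 1
    ext ω
    simp [smul_sub]

/-! ### Existence of the divergence -/

/-- The bound forces `l` to vanish on the kernel of `A`, so `l` descends to a bounded functional on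
the range. Hahn–Banach extends it to `E` and Riesz represents it. For the divergence, `V` is the
closed graph and `A` its first projection. -/
theorem exists_inner_eq_of_abs_le {V E : Type*} [AddCommGroup V] [Module ℝ V]
    [NormedAddCommGroup E] [InnerProductSpace ℝ E] [CompleteSpace E] (A : V →ₗ[ℝ] E)
    (l : V →ₗ[ℝ] ℝ) (C : ℝ) (hC : ∀ z, |l z| ≤ C * ‖A z‖) :
    ∃ v : E, ∀ z, l z = inner ℝ v (A z) := by
  obtain ⟨s, hs⟩ := A.rangeRestrict.exists_rightInverse_of_surjective A.range_rangeRestrict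
  have hAs : ∀ y : LinearMap.range A, A (s y) = y := fun y =>
    congrArg Subtype.val (LinearMap.congr_fun hs y)
  have hls : ∀ z, l (s (A.rangeRestrict z)) = l z := fun z => by
    have h := hC (s (A.rangeRestrict z) - z)
    rw [map_sub A, hAs, LinearMap.codRestrict_apply, sub_self, norm_zero, mul_zero, map_sub] at h
    exact sub_eq_zero.1 (abs_nonpos_iff.1 h)
  let L : LinearMap.range A →L[ℝ] ℝ := (l ∘ₗ s).mkContinuous C fun y => by
    simpa [hAs] using hC (s y)
  obtain ⟨L', hL', -⟩ := exists_extension_norm_eq (LinearMap.range A) L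
  refine ⟨(InnerProductSpace.toDual ℝ E).symm L', fun z => ?_⟩
  rw [InnerProductSpace.toDual_symm_apply, ← hls z]
  exact (hL' (A.rangeRestrict z)).symm

theorem exists_hasDivergence {W : H ≃ₗᵢ[ℝ] H₁} {u : Lp H 2 P} (hu : u ∈ divergenceDomain W) :
    ∃ v, HasDivergence W u v := by
  obtain ⟨C, hC⟩ := hu
  let A : malliavinGraph W →ₗ[ℝ] Lp ℝ 2 P :=
    LinearMap.fst ℝ (Lp ℝ 2 P) (Lp H 2 P) ∘ₗ (malliavinGraph W).subtype
  let B : malliavinGraph W →ₗ[ℝ] Lp H 2 P :=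
    LinearMap.snd ℝ (Lp ℝ 2 P) (Lp H 2 P) ∘ₗ (malliavinGraph W).subtype
  let l : malliavinGraph W →ₗ[ℝ] ℝ := (innerₗ (Lp H 2 P) u) ∘ₗ B
  have hl : ∀ z, l z = ∫ ω, inner ℝ ((z.1.2 : Lp H 2 P) ω) (u ω) ∂P := fun z => by
    change inner ℝ u z.1.2 = _
    rw [real_inner_comm, L2.inner_def]
  obtain ⟨v, hv⟩ := exists_inner_eq_of_abs_le A l C fun z => by
    rw [hl]
    exact hC _ _ z.2
  refine ⟨v, fun F G hFG => ?_⟩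
  have h1 := hv ⟨(F, G), hFG⟩
  rw [hl] at h1
  rw [h1]
  change _ = inner ℝ v F
  rw [L2.inner_def]
  rfl

theorem hasDivergence_divergence {W : H ≃ₗᵢ[ℝ] H₁} {u : Lp H 2 P}
    (hu : u ∈ divergenceDomain W) : HasDivergence W u (divergence W u) := by
  have h := exists_hasDivergence hu
  rw [divergence, dif_pos h]
  exact h.choose_spec

theorem hasMalliavinDeriv_malliavinDeriv {W : H ≃ₗᵢ[ℝ] H₁} {F : Lp ℝ 2 P} (hF : F ∈ D12 W) :
    HasMalliavinDeriv W F (malliavinDeriv W F) := by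
  have h : ∃ G, HasMalliavinDeriv W F G := hF
  rw [malliavinDeriv, dif_pos h]
  exact h.choose_spec

theorem HasDivergence.integral_eq {W : H ≃ₗᵢ[ℝ] H₁} {u : Lp H 2 P} {v : Lp ℝ 2 P}
    (h : HasDivergence W u v) {f : Ω → ℝ} {g : Ω → H} (hfg : DerivPair W f g) :
    ∫ ω, f ω * v ω ∂P = ∫ ω, inner ℝ (g ω) (u ω) ∂P := by
  obtain ⟨F, G, hFG, hF, hG⟩ := hfg
  calc ∫ ω, f ω * v ω ∂P = ∫ ω, F ω * v ω ∂P :=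
        integral_congr_ae (by filter_upwards [hF] with ω hω; rw [hω])
    _ = ∫ ω, inner ℝ (G ω) (u ω) ∂P := h F G hFG
    _ = _ := integral_congr_ae (by filter_upwards [hG] with ω hω; rw [hω])

/-! ### Densities from integration by parts -/

/-- The function `x ↦ E[1_{X > x} w]`. -/
noncomputable def tailIntegral (P : Measure Ω) (X w : Ω → ℝ) (x : ℝ) : ℝ :=
  ∫ ω, Set.indicator {ω' | x < X ω'} (fun _ => (1 : ℝ)) ω * w ω ∂P

variable {X w : Ω → ℝ}

theorem abs_indicator_one_mul_le {α : Type*} (s : Set α) (a : α) (c : ℝ) :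
    |s.indicator (fun _ => (1 : ℝ)) a * c| ≤ |c| := by
  by_cases h : a ∈ s <;> simp [h]

theorem measurable_tailIntegrand (hX : Measurable X) (hw : Measurable w) :
    Measurable fun z : ℝ × Ω => Set.indicator {ω' | z.1 < X ω'} (fun _ => (1 : ℝ)) z.2 * w z.2 := by
  have h : MeasurableSet {z : ℝ × Ω | z.1 < X z.2} :=
    measurableSet_lt measurable_fst (hX.comp measurable_snd)
  exact ((measurable_const (a := (1 : ℝ))).indicator h).mul (hw.comp measurable_snd)

theorem measurable_tailIntegral [SFinite P] (hX : Measurable X) (hw : Measurable w) :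
    Measurable (tailIntegral P X w) :=
  (measurable_tailIntegrand hX hw).stronglyMeasurable.integral_prod_right.measurable

theorem integrable_tailIntegrand (hX : Measurable X) (hwi : Integrable w P) (x : ℝ) :
    Integrable (fun ω => Set.indicator {ω' | x < X ω'} (fun _ => (1 : ℝ)) ω * w ω) P :=
  hwi.norm.mono' (((measurable_const (a := (1 : ℝ))).indicator
    (measurableSet_lt measurable_const hX)).aestronglyMeasurable.mul hwi.aestronglyMeasurable)
    (Eventually.of_forall fun _ => abs_indicator_one_mul_le _ _ _)

theorem abs_tailIntegral_le (hwi : Integrable w P) (x : ℝ) :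
    |tailIntegral P X w x| ≤ ∫ ω, |w ω| ∂P :=
  norm_integral_le_of_norm_le (f := fun ω => Set.indicator {ω' | x < X ω'} (fun _ => (1 : ℝ)) ω * w ω)
    hwi.norm (Eventually.of_forall fun _ => abs_indicator_one_mul_le _ _ _)

theorem tailIntegral_nonneg (hw : ∀ ω, 0 ≤ w ω) (x : ℝ) : 0 ≤ tailIntegral P X w x :=
  integral_nonneg fun ω => mul_nonneg (Set.indicator_nonneg (fun _ _ => zero_le_one) ω) (hw ω)

/-- Fubini; the integrand is dominated by the product `|w| |ψ|`. -/
theorem integral_setIntegral_Iic_mul [SFinite P] (hX : Measurable X) (hw : Measurable w)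
    (hwi : Integrable w P) {ψ : ℝ → ℝ} (hψ : Measurable ψ) (hψi : Integrable ψ) :
    ∫ ω, (∫ y in Set.Iic (X ω), ψ y) * w ω ∂P = ∫ y, ψ y * tailIntegral P X w y := by
  have hint : Integrable (fun z : Ω × ℝ =>
      ψ z.2 * (Set.indicator {ω' | z.2 < X ω'} (fun _ => (1 : ℝ)) z.1 * w z.1)) (P.prod volume) := by
    refine (hwi.mul_prod hψi).norm.mono' ((hψ.comp measurable_snd).mul
      ((measurable_tailIntegrand hX hw).comp measurable_swap)).aestronglyMeasurable
      (Eventually.of_forall fun z => ?_)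
    rw [norm_mul, norm_mul (w z.1), mul_comm ‖w z.1‖]
    exact mul_le_mul_of_nonneg_left (abs_indicator_one_mul_le _ _ _) (norm_nonneg _)
  calc ∫ ω, (∫ y in Set.Iic (X ω), ψ y) * w ω ∂P
      = ∫ ω, (∫ y, ψ y * (Set.indicator {ω' | y < X ω'} (fun _ => (1 : ℝ)) ω * w ω)) ∂P := by
        refine integral_congr_ae (Eventually.of_forall fun ω => ?_)
        simp only
        -- The endpoint is Lebesgue-null, and removing it matches the strict inequality in
        -- `tailIntegral`.
        rw [integral_Iic_eq_integral_Iio, ← integral_indicator measurableSet_Iio,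
          ← integral_mul_const]
        congr 1
        ext y
        by_cases h : y < X ω <;> simp [h]
    _ = ∫ y : ℝ, ∫ ω, ψ y * (Set.indicator {ω' | y < X ω'} (fun _ => (1 : ℝ)) ω * w ω) ∂P :=
        integral_integral_swap hint
    _ = _ := by simp only [integral_const_mul, tailIntegral]

theorem hasDerivAt_setIntegral_Iic {ψ : ℝ → ℝ} (hψ : Continuous ψ) (hψi : Integrable ψ) (x : ℝ) :
    HasDerivAt (fun x => ∫ y in Set.Iic x, ψ y) (ψ x) x := by
  have h := (hψ.integral_hasStrictDerivAt 0 x).hasDerivAt.const_add (∫ y in Set.Iic 0, ψ y)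
  refine h.congr_of_eventuallyEq (Eventually.of_forall fun z => ?_)
  simp only
  rw [← intervalIntegral.integral_Iic_sub_Iic hψi.integrableOn hψi.integrableOn]
  ring

/-- For fixed `ω` the integrand, as a function of the threshold, can jump only at `X ω`; without
atoms this almost surely differs from the given point, so dominated convergence applies. -/
theorem continuous_tailIntegral (hX : Measurable X) (hwi : Integrable w P)
    (hatom : ∀ x, ∀ᵐ ω ∂P, X ω ≠ x) : Continuous (tailIntegral P X w) := by
  refine continuous_iff_continuousAt.2 fun x => ?_
  refine continuousAt_of_dominated
    (Eventually.of_forall fun y => (integrable_tailIntegrand hX hwi y).aestronglyMeasurable)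
    (Eventually.of_forall fun y => Eventually.of_forall fun ω => abs_indicator_one_mul_le _ _ _)
    hwi.norm ?_
  filter_upwards [hatom x] with ω hω
  refine ContinuousAt.mul ?_ continuousAt_const
  rcases lt_or_gt_of_ne hω with h | h
  · refine continuousAt_const.congr (f := fun _ => 0) ?_
    filter_upwards [lt_mem_nhds h] with y hy
    simp [hy.le]
  · refine continuousAt_const.congr (f := fun _ => 1) ?_
    filter_upwards [gt_mem_nhds h] with y hy
    simp [hy]

theorem isLocallyFiniteMeasure_withDensity_ofReal {q : ℝ → ℝ} {C : ℝ} (hq : ∀ x, |q x| ≤ C) :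
    IsLocallyFiniteMeasure (volume.withDensity fun x => ENNReal.ofReal (q x)) := by
  have h : volume.withDensity (fun x => ENNReal.ofReal (q x)) ≤
      volume.withDensity (fun _ => ENNReal.ofReal C) :=
    withDensity_mono (Eventually.of_forall fun x =>
      ENNReal.ofReal_le_ofReal ((le_abs_self _).trans (hq x)))
  rw [withDensity_const] at h
  have : IsLocallyFiniteMeasure (ENNReal.ofReal C • (volume : Measure ℝ)) :=
    inferInstanceAs (IsLocallyFiniteMeasure (C.toNNReal • (volume : Measure ℝ)))
  exact Measure.isLocallyFiniteMeasure_of_le h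

/-- Integration by parts `E[φ'(X)] = E[φ(X) v]` implies that `X` has density `x ↦ E[1_{X > x} v]`. -/
theorem map_eq_withDensity_tailIntegral [IsFiniteMeasure P] {v : Ω → ℝ} (hX : Measurable X)
    (hv : Measurable v) (hvi : Integrable v P)
    (h : ∀ φ ψ : ℝ → ℝ, Continuous ψ → HasCompactSupport ψ → (∀ x, HasDerivAt φ (ψ x) x) →
      ∫ ω, ψ (X ω) ∂P = ∫ ω, φ (X ω) * v ω ∂P) :
    (∀ᵐ x, 0 ≤ tailIntegral P X v x) ∧
      P.map X = volume.withDensity fun x => ENNReal.ofReal (tailIntegral P X v x) := by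
  -- The sign of the candidate density is not yet known. Splitting `v` writes it as `q - r` with `q`
  -- and `r` nonnegative and bounded, so that only positive measures have to be compared.
  set vp : Ω → ℝ := fun ω => max (v ω) 0 with hvp
  set vm : Ω → ℝ := fun ω => max (-v ω) 0 with hvm
  have hvpm : Measurable vp := hv.max measurable_const
  have hvmm : Measurable vm := hv.neg.max measurable_const
  have hvpi : Integrable vp P := hvi.pos_part
  have hvmi : Integrable vm P := hvi.neg_part
  set q : ℝ → ℝ := tailIntegral P X vp with hq
  set r : ℝ → ℝ := tailIntegral P X vm with hr
  have hq0 : ∀ x, 0 ≤ q x := tailIntegral_nonneg fun ω => le_max_right _ _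
  have hr0 : ∀ x, 0 ≤ r x := tailIntegral_nonneg fun ω => le_max_right _ _
  have hqm : Measurable q := measurable_tailIntegral hX hvpm
  have hrm : Measurable r := measurable_tailIntegral hX hvmm
  have hqr : ∀ x, tailIntegral P X v x = q x - r x := fun x => by
    rw [hq, hr, tailIntegral, tailIntegral, tailIntegral, ← integral_sub
      (integrable_tailIntegrand hX hvpi x) (integrable_tailIntegrand hX hvmi x)]
    refine integral_congr_ae (Eventually.of_forall fun ω => ?_)
    simp only [hvp, hvm]
    rw [← mul_sub, max_zero_sub_max_neg_zero_eq_self]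
  have hlq : IsLocallyFiniteMeasure (volume.withDensity fun x => ENNReal.ofReal (q x)) :=
    isLocallyFiniteMeasure_withDensity_ofReal (abs_tailIntegral_le hvpi)
  have hlr : IsLocallyFiniteMeasure (volume.withDensity fun x => ENNReal.ofReal (r x)) :=
    isLocallyFiniteMeasure_withDensity_ofReal (abs_tailIntegral_le hvmi)
  have hwd : ∀ {s : ℝ → ℝ}, Measurable s → (∀ x, 0 ≤ s x) → ∀ f : ℝ → ℝ,
      ∫ x, f x ∂(volume.withDensity fun x => ENNReal.ofReal (s x)) = ∫ x, f x * s x := by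
    intro s hs hs0 f
    rw [integral_withDensity_eq_integral_toReal_smul hs.ennreal_ofReal
      (Eventually.of_forall fun _ => ENNReal.ofReal_lt_top)]
    refine integral_congr_ae (Eventually.of_forall fun x => ?_)
    simp only [ENNReal.toReal_ofReal (hs0 x), smul_eq_mul, mul_comm]
  have hbdd : ∀ {s : ℝ → ℝ} {C : ℝ} {ψ : ℝ → ℝ}, Measurable s → (∀ x, |s x| ≤ C) →
      Integrable ψ → Integrable fun x => ψ x * s x := fun hs hC hψ =>
    hψ.mul_bdd hs.aestronglyMeasurable (Eventually.of_forall hC)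
  have hls : IsLocallyFiniteMeasure
      (P.map X + volume.withDensity fun x => ENNReal.ofReal (r x)) := by
    refine ⟨fun x => ?_⟩
    obtain ⟨s, hs, hs'⟩ := hlr.finiteAtNhds x
    refine ⟨s, hs, ?_⟩
    rw [Measure.add_apply]
    exact ENNReal.add_lt_top.2 ⟨measure_lt_top _ _, hs'⟩
  -- The identity `E[ψ(X)] = ∫ ψ (q - r)` with the negative part moved to the left; locally finite
  -- measures are determined by compactly supported continuous functions.
  have hμ : P.map X + volume.withDensity (fun x => ENNReal.ofReal (r x)) =
      volume.withDensity fun x => ENNReal.ofReal (q x) := by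
    refine Measure.ext_of_integral_eq_on_compactlySupported fun f => ?_
    have hfc : Continuous (f : ℝ → ℝ) := f.continuous
    have hfi : ∀ (ν : Measure ℝ) [IsLocallyFiniteMeasure ν], Integrable f ν := fun ν _ =>
      hfc.integrable_of_hasCompactSupport f.hasCompactSupport
    rw [integral_add_measure (hfi _) (hfi _), hwd hrm hr0, hwd hqm hq0,
      integral_map hX.aemeasurable hfc.aestronglyMeasurable,
      h _ f hfc f.hasCompactSupport (hasDerivAt_setIntegral_Iic hfc (hfi _)),
      integral_setIntegral_Iic_mul hX hv hvi hfc.measurable (hfi _)]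
    simp only [hqr, mul_sub]
    rw [integral_sub (hbdd hqm (abs_tailIntegral_le hvpi) (hfi _))
      (hbdd hrm (abs_tailIntegral_le hvmi) (hfi _)), sub_add_cancel]
  have hac : P.map X ≪ volume := by
    refine Measure.AbsolutelyContinuous.trans (Measure.absolutelyContinuous_of_le ?_)
      (withDensity_absolutelyContinuous volume fun x => ENNReal.ofReal (q x))
    rw [← hμ]
    exact Measure.le_add_right le_rfl
  have hd := Measure.withDensity_rnDeriv_eq _ _ hac
  -- Comparing densities gives `r ≤ q` a.e., hence nonnegativity of the candidate, and identifies
  -- the density of the law as `q - r`.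
  have hae : (fun x => (P.map X).rnDeriv volume x + ENNReal.ofReal (r x)) =ᵐ[volume]
      fun x => ENNReal.ofReal (q x) := by
    refine (withDensity_eq_iff_of_sigmaFinite
      ((Measure.measurable_rnDeriv _ _).add hrm.ennreal_ofReal).aemeasurable
      hqm.ennreal_ofReal.aemeasurable).1 ?_
    rw [← hμ]
    conv_rhs => rw [← hd]
    exact withDensity_add_left (Measure.measurable_rnDeriv _ _) _
  constructor
  · filter_upwards [hae] with x hx
    rw [hqr, sub_nonneg, ← ENNReal.ofReal_le_ofReal_iff (hq0 x), ← hx]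
    exact le_add_self
  · rw [← hd]
    refine withDensity_congr_ae ?_
    filter_upwards [hae] with x hx
    rw [hqr, ENNReal.ofReal_sub _ (hr0 x), ← hx, ENNReal.add_sub_cancel_right ENNReal.ofReal_ne_top]

theorem nonneg_of_ae_nonneg_of_continuous {p : ℝ → ℝ} (hp : Continuous p) (h : ∀ᵐ x, 0 ≤ p x)
    (x : ℝ) : 0 ≤ p x := by
  by_contra hx
  have ho : IsOpen {y | ¬ 0 ≤ p y} := by
    simpa only [not_le] using isOpen_lt hp continuous_const
  have := (ho.measure_eq_zero_iff volume).1 (ae_iff.1 h)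
  exact (this ▸ hx : x ∈ (∅ : Set ℝ))

end Malliavin

/-! ### The density formula -/

theorem mainTheorem10
    {Ω : Type*} [mΩ : MeasurableSpace Ω] {P : Measure Ω} [IsProbabilityMeasure P]
    {H : Type*} [NormedAddCommGroup H] [InnerProductSpace ℝ H] [CompleteSpace H]
    [TopologicalSpace.SeparableSpace H]
    {H₁ : Submodule ℝ (Lp ℝ 2 P)} (hH₁ : Malliavin.IsGaussianHilbertSpace H₁)
    (hσ : mΩ = Malliavin.generatedSigmaField H₁)
    (W : H ≃ₗᵢ[ℝ] H₁)
    (F : Lp ℝ 2 P) (hF : F ∈ Malliavin.D12 W)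
    (hpos : ∀ᵐ ω ∂P, 0 < ‖Malliavin.malliavinDeriv W F ω‖)
    (u : Lp H 2 P)
    (hu : (u : Ω → H) =ᵐ[P] fun ω =>
      (‖Malliavin.malliavinDeriv W F ω‖ ^ 2)⁻¹ • Malliavin.malliavinDeriv W F ω)
    (hdom : u ∈ Malliavin.divergenceDomain W) :
    ∃ p : ℝ → ℝ,
      (∀ x, p x = ∫ ω, Set.indicator {ω' | x < F ω'} (fun _ => (1 : ℝ)) ω *
        Malliavin.divergence W u ω ∂P) ∧
      Continuous p ∧ (∃ C : ℝ, ∀ x, |p x| ≤ C) ∧ (∀ x, 0 ≤ p x) ∧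
      P.map (F : Ω → ℝ) = volume.withDensity (fun x => ENNReal.ofReal (p x)) := by
  have hX : Measurable (F : Ω → ℝ) := (Lp.stronglyMeasurable F).measurable
  have hv : Measurable (Malliavin.divergence W u : Ω → ℝ) := (Lp.stronglyMeasurable _).measurable
  have hvi : Integrable (Malliavin.divergence W u : Ω → ℝ) P :=
    (Lp.memLp (Malliavin.divergence W u)).integrable one_le_two
  have hibp : ∀ φ ψ : ℝ → ℝ, Continuous ψ → HasCompactSupport ψ → (∀ x, HasDerivAt φ (ψ x) x) →
      ∫ ω, ψ (F ω) ∂P = ∫ ω, φ (F ω) * Malliavin.divergence W u ω ∂P := by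
    intro φ ψ hψ hψs hφ
    obtain ⟨M, hM⟩ := hψ.bounded_above_of_compact_support hψs
    rw [(Malliavin.hasDivergence_divergence hdom).integral_eq
      ((Malliavin.hasMalliavinDeriv_malliavinDeriv hF).comp hH₁ hφ hψ hM)]
    refine integral_congr_ae ?_
    -- Here `⟨ψ(F) DF, DF / ‖DF‖²⟩ = ψ(F)`, which needs `DF ≠ 0`.
    filter_upwards [hu, hpos] with ω h1 h2
    rw [h1, real_inner_smul_left, real_inner_smul_right, real_inner_self_eq_norm_sq,
      inv_mul_cancel₀ (pow_ne_zero 2 h2.ne'), mul_one]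
  obtain ⟨hp0, hp⟩ := Malliavin.map_eq_withDensity_tailIntegral hX hv hvi hibp
  -- The absolute continuity just obtained excludes atoms; continuity of the density follows, and it
  -- upgrades nonnegativity from a.e. to every point.
  have hatom : ∀ x, ∀ᵐ ω ∂P, F ω ≠ x := fun x => by
    have h : P.map F {x} = 0 := by
      rw [hp]
      exact withDensity_absolutelyContinuous _ _ (measure_singleton x)
    rw [Measure.map_apply hX (measurableSet_singleton x)] at h
    rw [ae_iff]
    simpa [Set.preimage] using h
  have hpc := Malliavin.continuous_tailIntegral hX hvi hatom
  exact ⟨_, fun _ => rfl, hpc, ⟨_, Malliavin.abs_tailIntegral_le hvi⟩,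
    Malliavin.nonneg_of_ae_nonneg_of_continuous hpc hp0, hp⟩
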